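/- **Conventions.** A plot of a diffeological space $X$ is a smooth map $P:U\to X$ from an open set $U\subseteq\mathbb{R}^k$, for any $k\ge 0$; a subset of $X$ is D-open if its preimage under every plot is open. Products and subsets carry the product and subspace diffeologies. For a smooth map $f:X\to Y$ and a plot $P:U\to Y$, put $P^*X=\{(r,x)\in U\times X: P(r)=f(x)\}$ and $P^*f:P^*X\to U$, $(r,x)\mapsto r$. - A smooth map $g:X\to Y$ is a *submersion* if for each $x_0\in X$ there are a D-open $O\subseteq Y$ and a smooth $\sigma:O\to X$ with $g(\sigma(y))=y$ for all $y\in O$ and $x_0\in\sigma(O)$. It is *étale* if for each $x_0\in X$ there are D-open neighbourhoods $O$ of $x_0$ and $O'$ of $g(x_0)$ such that $g$ restricts to a diffeomorphism $O\to O'$. - A smooth map $f:X\to Y$ is a *diffeological submersion* (respectively a *diffeological étale map*) if $P^*f$ is a submersion (respectively étale) for every plot $P$ of $Y$. It is a *diffeological immersion* if for every plot $P:U\to Y$ and every $(r_0,x_0)\in P^*X$ there are a D-open neighbourhood $O$ of $(r_0,x_0)$ in $P^*X$, an open set $V\subseteq U$ containing $P^*f(O)$, and a smooth map $\varrho:V\to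 U\times X$ with $\varrho(r)=(r,x)$ for all $(r,x)\in O$. - A *diffeological étale $n$-manifold* is a diffeological space that is covered by the images of a family of diffeological étale maps defined on open subsets of $\mathbb{R}^n$. - The *internal tangent space* $T_xX$ is the colimit, in real vector spaces, of the spaces $T_0\,\mathrm{dom}(P)$ over the plots $P$ of $X$ with $0\in\mathrm{dom}(P)$ and $P(0)=x$. The morphisms $Q\to P$ are the germs at $0$ of smooth maps $F$ with $F(0)=0$ and $Q=P\circ F$ near $0$; they act by $dF_0$. Write $dP_0:T_0\,\mathrm{dom}(P)\to T_xX$ for the colimit maps. For a smooth map $f:X\to Y$, the *internal tangent map* $df_x:T_xX\to T_{f(x)}Y$ is the unique linear map with $df_x\circ dP_0=d(f\circ P)_0$ for all such $P$. **Theorem.** Let $\mathcal M$ and $\mathcal N$ be diffeological étale manifolds of dimensions $m$ and $n$, respectively, and let $f:\mathcal M\to\mathcal N$ be a smooth map. 1. If $df_x:T_x\mathcal M\to T_{f(x)}\mathcal N$ is surjective at each point $x\in\mathcal M$, then $f$ is a diffeological submersion. 2. If $df_x:T_x\mathcal M\to T_{f(x)}\mathcal N$ is injective at each point $x\in\mathcal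 M$, then $f$ is a diffeological immersion. 3. If $df_x:T_x\mathcal M\to T_{f(x)}\mathcal N$ is an isomorphism at each point $x\in\mathcal M$, then $f$ is a diffeological étale map. -/

import Mathlib

open TopologicalSpace Diffeology
open scoped ContDiff DirectSum Topology

universe u v w

namespace DiffeologicalEtale

/-! ### Subspaces, products, pullbacks

Diffeological spaces and smooth maps are those of Mathlib: a diffeology is given by its plots
`EuclideanSpace ℝ (Fin n) → X`, and `DSmooth` is smoothness. A plot defined on an `n`-domain,
i.e. on an open set `U` of `EuclideanSpace ℝ (Fin n)`, is a smooth map `U → X`, where `U` has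
the subspace diffeology. -/

/-- The subspace diffeology: the plots of the ambient space with values in the subspace. -/
instance instSubspace {X : Type u} [DiffeologicalSpace X] (p : X → Prop) :
    DiffeologicalSpace (Subtype p) where
  plots _ := {q | IsPlot fun r => (q r : X)}
  constant_plots _ := isPlot_const
  plot_reparam hp hf := isPlot_reparam (X := X) hp hf
  locality {n q} h := DiffeologicalSpace.locality (X := X) (p := fun r => (q r : X)) fun r => by
    obtain ⟨s, hs, hr, H⟩ := h r
    exact ⟨s, hs, hr, fun hfs hf => H hfs hf⟩

/-- The product diffeology: pairs of plots. -/
instance instProduct {X : Type u} {Y : Type v} [DiffeologicalSpace X] [DiffeologicalSpace Y] :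
    DiffeologicalSpace (X × Y) where
  plots _ := {q | IsPlot (fun r => (q r).1) ∧ IsPlot (fun r => (q r).2)}
  constant_plots _ := ⟨isPlot_const, isPlot_const⟩
  plot_reparam hp hf := ⟨isPlot_reparam hp.1 hf, isPlot_reparam hp.2 hf⟩
  locality {n q} h :=
    ⟨DiffeologicalSpace.locality (X := X) (p := fun r => (q r).1) fun r => by
      obtain ⟨s, hs, hr, H⟩ := h r
      exact ⟨s, hs, hr, fun hfs hf => (H hfs hf).1⟩,
    DiffeologicalSpace.locality (X := Y) (p := fun r => (q r).2) fun r => by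
      obtain ⟨s, hs, hr, H⟩ := h r
      exact ⟨s, hs, hr, fun hfs hf => (H hfs hf).2⟩⟩

/-- D-open subsets: open for the D-topology. -/
def IsDOpen {X : Type u} [DiffeologicalSpace X] (O : Set X) : Prop :=
  IsOpen[Diffeology.dTopology] O

/-- The space `g^*X = {(z, x) | g z = f x}`, a subspace of `Z × X`. -/
abbrev Pullback {X : Type u} {Y : Type v} {Z : Type w} (f : X → Y) (g : Z → Y) : Type (max u w) :=
  {p : Z × X // g p.1 = f p.2}

/-- The pullback `g^*f : g^*X → Z`, `(z, x) ↦ z`. -/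
def pullbackMap {X : Type u} {Y : Type v} {Z : Type w} (f : X → Y) (g : Z → Y) :
    Pullback f g → Z :=
  fun p => p.1.1

/-! ### Submersions, immersions, étale maps -/

/-- A submersion: through every point of `X` passes a smooth local section of `f` defined on a
D-open subset of `Y`. -/
def IsSubmersion {X : Type u} {Y : Type v} [DiffeologicalSpace X] [DiffeologicalSpace Y]
    (f : X → Y) : Prop :=
  DSmooth f ∧ ∀ x₀ : X, ∃ O : Set Y, IsDOpen O ∧ ∃ σ : O → X,
    DSmooth σ ∧ (∀ y : O, f (σ y) = y) ∧ x₀ ∈ Set.range σ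

/-- A diffeological submersion: the pullback by every plot in `Y` is a submersion. -/
def IsDiffeologicalSubmersion {X : Type u} {Y : Type v} [DiffeologicalSpace X]
    [DiffeologicalSpace Y] (f : X → Y) : Prop :=
  DSmooth f ∧ ∀ (n : ℕ) (U : Opens (EuclideanSpace ℝ (Fin n))) (P : U → Y), DSmooth P →
    IsSubmersion (pullbackMap f P)

/-- A diffeological immersion: for every plot `P : U → Y` and every point of `P^*X` there are a
D-open neighbourhood `O` of it in `P^*X`, an open set `V ⊆ U` containing `P^*f (O)`, and a smooth
map `ϱ : V → U × X` with `ϱ (P^*f (r, x)) = (r, x)` for all `(r, x) ∈ O`. -/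
def IsDiffeologicalImmersion {X : Type u} {Y : Type v} [DiffeologicalSpace X]
    [DiffeologicalSpace Y] (f : X → Y) : Prop :=
  DSmooth f ∧ ∀ (n : ℕ) (U : Opens (EuclideanSpace ℝ (Fin n))) (P : U → Y), DSmooth P →
    ∀ p₀ : Pullback f P, ∃ O : Set (Pullback f P), IsDOpen O ∧ p₀ ∈ O ∧
      ∃ (V : Set U) (hV : Set.MapsTo (pullbackMap f P) O V), IsOpen V ∧
        ∃ ϱ : V → U × X, DSmooth ϱ ∧
          ∀ (p : Pullback f P) (hp : p ∈ O), ϱ ⟨pullbackMap f P p, hV hp⟩ = p.1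

/-- A diffeomorphism: a smooth map with a smooth inverse. -/
def IsDiffeomorphism {X : Type u} {Y : Type v} [DiffeologicalSpace X] [DiffeologicalSpace Y]
    (f : X → Y) : Prop :=
  DSmooth f ∧ ∃ g : Y → X, DSmooth g ∧ Function.LeftInverse g f ∧ Function.RightInverse g f

/-- An étale map: it restricts to a diffeomorphism from some D-open neighbourhood of any given
point onto a D-open neighbourhood of the image point. -/
def IsEtale {X : Type u} {Y : Type v} [DiffeologicalSpace X] [DiffeologicalSpace Y]
    (f : X → Y) : Prop :=
  ∀ x₀ : X, ∃ (O : Set X) (O' : Set Y) (h : Set.MapsTo f O O'),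
    IsDOpen O ∧ IsDOpen O' ∧ x₀ ∈ O ∧ f x₀ ∈ O' ∧ IsDiffeomorphism (h.restrict f O O')

/-- A diffeological étale map: the pullback by every plot in `Y` is étale. -/
def IsDiffeologicalEtale {X : Type u} {Y : Type v} [DiffeologicalSpace X]
    [DiffeologicalSpace Y] (f : X → Y) : Prop :=
  DSmooth f ∧ ∀ (n : ℕ) (U : Opens (EuclideanSpace ℝ (Fin n))) (P : U → Y), DSmooth P →
    IsEtale (pullbackMap f P)

/-- A diffeological étale `n`-manifold: it is covered by the images of a family of diffeological
étale maps defined on `n`-domains. -/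
def IsEtaleManifold (n : ℕ) (M : Type u) [DiffeologicalSpace M] : Prop :=
  ∃ A : Set ((U : Opens (EuclideanSpace ℝ (Fin n))) × (U → M)),
    (∀ φ ∈ A, IsDiffeologicalEtale φ.2) ∧ ∀ x : M, ∃ φ ∈ A, x ∈ Set.range φ.2

/-! ### Internal tangent spaces -/

/-- A plot centered at `x`: a plot `P : U → X` with `0 ∈ U` and `P 0 = x`. -/
structure CenteredPlot (X : Type u) [DiffeologicalSpace X] (x : X) where
  /-- The dimension of the domain. -/
  dim : ℕ
  /-- The domain `U`. -/
  dom : Opens (EuclideanSpace ℝ (Fin dim))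
  zero_mem : 0 ∈ dom
  /-- The plot itself. -/
  toFun : dom → X
  smooth : DSmooth toFun
  map_zero : toFun ⟨0, zero_mem⟩ = x

/-- The plot `f ∘ P` centered at `f x`. -/
def CenteredPlot.map {X : Type u} {Y : Type v} [DiffeologicalSpace X] [DiffeologicalSpace Y]
    {f : X → Y} (hf : DSmooth f) {x : X} (P : CenteredPlot X x) : CenteredPlot Y (f x) where
  dim := P.dim
  dom := P.dom
  zero_mem := P.zero_mem
  toFun := fun r => f (P.toFun r)
  smooth := hf.comp P.smooth
  map_zero := congrArg f P.map_zero

/-- The map `F` represents a morphism `Q ⟶ P` of germs of plots centered at `x`: on some open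
neighbourhood `W ⊆ dom Q` of `0` it is smooth with values in `dom P`, it satisfies `F 0 = 0`, and
`Q = P ∘ F` on `W`. (Only the values of `F` on `W` matter.) -/
def IsPlotMorphism {X : Type u} [DiffeologicalSpace X] {x : X} (Q P : CenteredPlot X x)
    (F : EuclideanSpace ℝ (Fin Q.dim) → EuclideanSpace ℝ (Fin P.dim)) : Prop :=
  F 0 = 0 ∧ ∃ W : Opens (EuclideanSpace ℝ (Fin Q.dim)), 0 ∈ W ∧ ContDiffOn ℝ ∞ F W ∧
    ∀ r ∈ W, ∃ (hQ : r ∈ Q.dom) (hP : F r ∈ P.dom), Q.toFun ⟨r, hQ⟩ = P.toFun ⟨F r, hP⟩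

/-- The direct sum of the tangent spaces `T₀(dom P)` over all plots `P` centered at `x`. -/
abbrev PlotSum (X : Type u) [DiffeologicalSpace X] (x : X) : Type u :=
  ⨁ P : CenteredPlot X x, EuclideanSpace ℝ (Fin P.dim)

open Classical in
/-- The inclusion of the summand `T₀(dom P)`. -/
noncomputable def plotIncl {X : Type u} [DiffeologicalSpace X] {x : X} (P : CenteredPlot X x) :
    EuclideanSpace ℝ (Fin P.dim) →ₗ[ℝ] PlotSum X x :=
  DirectSum.lof ℝ (CenteredPlot X x) (fun P => EuclideanSpace ℝ (Fin P.dim)) P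

/-- The relations identifying `v ∈ T₀(dom Q)` with `dF₀ v ∈ T₀(dom P)` for every morphism
`F : Q ⟶ P` of germs of centered plots. -/
def plotRel (X : Type u) [DiffeologicalSpace X] (x : X) : Submodule ℝ (PlotSum X x) :=
  Submodule.span ℝ {z | ∃ (Q P : CenteredPlot X x)
    (F : EuclideanSpace ℝ (Fin Q.dim) → EuclideanSpace ℝ (Fin P.dim))
    (v : EuclideanSpace ℝ (Fin Q.dim)),
    IsPlotMorphism Q P F ∧ z = plotIncl Q v - plotIncl P (fderiv ℝ F 0 v)}

/-- The internal tangent space `T_x X`: the colimit of the vector spaces `T₀(dom P)` over the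
category of germs of plots `P` centered at `x`, as the direct sum modulo the relations of the
diagram. -/
abbrev InternalTangentSpace (X : Type u) [DiffeologicalSpace X] (x : X) : Type u :=
  PlotSum X x ⧸ plotRel X x

/-- The linear map `dP₀ : T₀(dom P) → T_x X` of the colimit cocone. -/
noncomputable def dPlot {X : Type u} [DiffeologicalSpace X] {x : X} (P : CenteredPlot X x) :
    EuclideanSpace ℝ (Fin P.dim) →ₗ[ℝ] InternalTangentSpace X x :=
  (plotRel X x).mkQ ∘ₗ plotIncl P

theorem dPlot_comp {X : Type u} [DiffeologicalSpace X] {x : X} {Q P : CenteredPlot X x}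
    {F : EuclideanSpace ℝ (Fin Q.dim) → EuclideanSpace ℝ (Fin P.dim)}
    (hF : IsPlotMorphism Q P F) (v : EuclideanSpace ℝ (Fin Q.dim)) :
    dPlot P (fderiv ℝ F 0 v) = dPlot Q v :=
  ((Submodule.Quotient.eq (plotRel X x)).2 (Submodule.subset_span
    (show plotIncl Q v - plotIncl P (fderiv ℝ F 0 v) ∈ _ from ⟨Q, P, F, v, hF, rfl⟩))).symm

theorem IsPlotMorphism.map {X : Type u} {Y : Type v} [DiffeologicalSpace X] [DiffeologicalSpace Y]
    {f : X → Y} (hf : DSmooth f) {x : X} {Q P : CenteredPlot X x}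
    {F : EuclideanSpace ℝ (Fin Q.dim) → EuclideanSpace ℝ (Fin P.dim)}
    (hF : IsPlotMorphism Q P F) : IsPlotMorphism (Q.map hf) (P.map hf) F := by
  obtain ⟨h0, W, hW, hc, h⟩ := hF
  refine ⟨h0, W, hW, hc, fun r hr => ?_⟩
  obtain ⟨hQ, hP, e⟩ := h r hr
  exact ⟨hQ, hP, congrArg f e⟩

open Classical in
/-- The cocone `d(f ∘ P)₀ : T₀(dom P) → T_{f x} Y`, as a map on the direct sum. -/
noncomputable def tangentMapAux {X : Type u} {Y : Type v} [DiffeologicalSpace X]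
    [DiffeologicalSpace Y] {f : X → Y} (hf : DSmooth f) (x : X) :
    PlotSum X x →ₗ[ℝ] InternalTangentSpace Y (f x) :=
  DirectSum.toModule ℝ (CenteredPlot X x) (InternalTangentSpace Y (f x))
    fun P => dPlot (P.map hf)

theorem tangentMapAux_plotIncl {X : Type u} {Y : Type v} [DiffeologicalSpace X]
    [DiffeologicalSpace Y] {f : X → Y} (hf : DSmooth f) {x : X} (P : CenteredPlot X x)
    (v : EuclideanSpace ℝ (Fin P.dim)) :
    tangentMapAux hf x (plotIncl P v) = dPlot (P.map hf) v := by
  classical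
  unfold tangentMapAux plotIncl
  exact DirectSum.toModule_lof (M := fun P : CenteredPlot X x => EuclideanSpace ℝ (Fin P.dim))
    ℝ P v

theorem plotRel_le_ker {X : Type u} {Y : Type v} [DiffeologicalSpace X]
    [DiffeologicalSpace Y] {f : X → Y} (hf : DSmooth f) (x : X) :
    plotRel X x ≤ LinearMap.ker (tangentMapAux hf x) := by
  refine Submodule.span_le.2 ?_
  rintro _ ⟨Q, P, F, v, hF, rfl⟩
  rw [SetLike.mem_coe, LinearMap.mem_ker, map_sub, tangentMapAux_plotIncl,
    tangentMapAux_plotIncl, sub_eq_zero]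
  exact (dPlot_comp (hF.map hf) v).symm

/-- The internal tangent map `df_x : T_x X → T_{f x} Y`, induced by the universal property of the
colimit. -/
noncomputable def tangentMap {X : Type u} {Y : Type v} [DiffeologicalSpace X]
    [DiffeologicalSpace Y] {f : X → Y} (hf : DSmooth f) (x : X) :
    InternalTangentSpace X x →ₗ[ℝ] InternalTangentSpace Y (f x) :=
  (plotRel X x).liftQ (tangentMapAux hf x) (plotRel_le_ker hf x)

/-- The characterizing property `df_x ∘ dP₀ = d(f ∘ P)₀`. -/
theorem tangentMap_dPlot {X : Type u} {Y : Type v} [DiffeologicalSpace X]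
    [DiffeologicalSpace Y] {f : X → Y} (hf : DSmooth f) {x : X} (P : CenteredPlot X x)
    (v : EuclideanSpace ℝ (Fin P.dim)) :
    tangentMap hf x (dPlot P v) = dPlot (P.map hf) v :=
  tangentMapAux_plotIncl hf P v

end DiffeologicalEtale

/-! Étale charts need not be injective, so there are no transition maps to work with. Their
substitute is unique lifting: given a chart `φ`, a plot `P` and a point `u₀` over `P r₀`, there is
exactly one smooth germ `L` at `r₀` with `φ ∘ L = P` and `L r₀ = u₀`
(`IsDiffeologicalEtale.exists_isLiftAt`).

Every centered plot thus factors through the chart by a unique germ, which identifies the tangent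
space with the coordinate space of the chart. Lifting `f ∘ φ` through a chart `ψ` of the target
gives a smooth `F` between Euclidean spaces whose derivative represents the tangent map. The inverse
function theorem then gives a one-sided local inverse `s` of `F`.

If `L` lifts `P` through `ψ`, all three claims rest on the map `r ↦ (r, φ (s (L r)))`. When `s` is a
right inverse it is a section of `P^*f`. When `s` is a left inverse it recovers every point of the
set where `x = φ u` and `F u = L r`; this set is D-open by uniqueness of lifts
(`isDOpen_matchedSet`). In the bijective case both hold at once. -/

namespace DiffeologicalEtale

/-! ### Smooth maps and D-open sets near a point of a Euclidean space -/

/-- A Euclidean space maps smoothly into any neighbourhood `S` of a point `r₀`, by a map with a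
smooth section near `r₀`. -/
theorem exists_smooth_retract {k : ℕ} {r₀ : EuclideanSpace ℝ (Fin k)}
    {S : Set (EuclideanSpace ℝ (Fin k))} (hS : S ∈ 𝓝 r₀) :
    ∃ e e' : EuclideanSpace ℝ (Fin k) → EuclideanSpace ℝ (Fin k),
      ContDiff ℝ ∞ e ∧ (∀ t, e t ∈ S) ∧
      ∀ᶠ r in 𝓝 r₀, ContDiffAt ℝ ∞ e' r ∧ e (e' r) = r := by
  obtain ⟨ε, hε, hb⟩ := Metric.mem_nhds_iff.1 hS
  refine ⟨OpenPartialHomeomorph.univBall r₀ ε, (OpenPartialHomeomorph.univBall r₀ ε).symm,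
    OpenPartialHomeomorph.contDiff_univBall, fun t => hb ?_, ?_⟩
  · have h := (OpenPartialHomeomorph.univBall r₀ ε).map_source (x := t)
    rw [OpenPartialHomeomorph.univBall_target r₀ hε] at h
    exact h (by simp)
  · filter_upwards [Metric.ball_mem_nhds r₀ hε] with r hr
    refine ⟨OpenPartialHomeomorph.contDiffOn_univBall_symm.contDiffAt
      (Metric.isOpen_ball.mem_nhds hr), ?_⟩
    exact OpenPartialHomeomorph.right_inv _
      (by rwa [OpenPartialHomeomorph.univBall_target r₀ hε])

theorem isPlot_subtype_val {X : Type u} [DiffeologicalSpace X] {p : X → Prop} {k : ℕ}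
    {q : EuclideanSpace ℝ (Fin k) → Subtype p} :
    IsPlot q ↔ IsPlot (fun t => (q t : X)) := Iff.rfl

theorem dSmooth_pullbackMap {X : Type u} {Y : Type v} {Z : Type w} [DiffeologicalSpace X]
    [DiffeologicalSpace Z] (f : X → Y) (g : Z → Y) : DSmooth (pullbackMap f g) :=
  fun _ _ hp => hp.1

/-- D-openness is tested on plots defined on a whole Euclidean space, so the inclusion of `W` is
replaced by the retraction `e`, and the resulting open set is pulled back along its local section
`e'`. -/
theorem eventually_mem_of_isDOpen {k : ℕ} {W : Opens (EuclideanSpace ℝ (Fin k))} {O : Set W}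
    (hO : IsDOpen O) {r₀ : W} (hr₀ : r₀ ∈ O) :
    ∀ᶠ r in 𝓝 (r₀ : EuclideanSpace ℝ (Fin k)), ∃ h : r ∈ W, (⟨r, h⟩ : W) ∈ O := by
  obtain ⟨e, e', he, heW, hee⟩ := exists_smooth_retract (W.isOpen.mem_nhds r₀.2)
  have hpl : IsPlot (fun t => (⟨e t, heW t⟩ : W)) := isPlot_subtype_val.2 he.isPlot
  have ho := isOpen_iff_preimages_plots.1 hO _ _ hpl
  have h0 := hee.self_of_nhds
  have hc : ∀ᶠ r in 𝓝 (r₀ : EuclideanSpace ℝ (Fin k)),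
      e' r ∈ (fun t => (⟨e t, heW t⟩ : W)) ⁻¹' O := by
    refine h0.1.continuousAt.eventually_mem (ho.mem_nhds ?_)
    have : (⟨e (e' r₀), heW _⟩ : W) = r₀ := Subtype.ext h0.2
    simpa [this] using hr₀
  filter_upwards [hc, hee] with r h1 h2
  have : (⟨e (e' r), heW _⟩ : W) ∈ O := h1
  exact ⟨h2.2 ▸ heW _, by simpa [h2.2] using this⟩

theorem isDOpen_of_isOpen {k : ℕ} {W : Opens (EuclideanSpace ℝ (Fin k))}
    {B : Set (EuclideanSpace ℝ (Fin k))} (hB : IsOpen B) : IsDOpen (Subtype.val ⁻¹' B : Set W) :=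
  isOpen_iff_preimages_plots.2 fun _ _ hp =>
    hB.preimage (isPlot_subtype_val.1 hp).contDiff.continuous

theorem isDOpen_of_eventually_isPlot {X : Type u} [DiffeologicalSpace X] {O : Set X}
    (h : ∀ (k : ℕ) (p : EuclideanSpace ℝ (Fin k) → X), IsPlot p → ∀ t₀, p t₀ ∈ O →
      ∀ᶠ t in 𝓝 t₀, p t ∈ O) : IsDOpen O :=
  isOpen_iff_preimages_plots.2 fun k p hp => isOpen_iff_mem_nhds.2 fun t₀ ht => h k p hp t₀ ht

/-! ### Lifts of plots -/

/-- Near `r₀`, the map `L` is smooth and lifts `P` through `φ`. -/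
def IsLiftAt {X : Type u} {m k : ℕ} {U : Opens (EuclideanSpace ℝ (Fin m))}
    {W : Opens (EuclideanSpace ℝ (Fin k))} (φ : U → X) (P : W → X)
    (L : EuclideanSpace ℝ (Fin k) → EuclideanSpace ℝ (Fin m))
    (r₀ : EuclideanSpace ℝ (Fin k)) : Prop :=
  ∀ᶠ r in 𝓝 r₀, ContDiffAt ℝ ∞ L r ∧ ∃ (hr : r ∈ W) (hu : L r ∈ U), φ ⟨L r, hu⟩ = P ⟨r, hr⟩

section Lift

variable {X : Type u} [DiffeologicalSpace X] {m k : ℕ} {U : Opens (EuclideanSpace ℝ (Fin m))}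
    {W : Opens (EuclideanSpace ℝ (Fin k))} {φ : U → X} {P : W → X}

/-- The lift is the second component of the local inverse `g` of `P^*φ`. A competing lift `L'` gives
a plot `r ↦ (r, L' r)` of the pullback, which stays in the D-open set `O` near `r₀`, where `P^*φ` is
injective. -/
theorem IsDiffeologicalEtale.exists_isLiftAt (hφ : IsDiffeologicalEtale φ) (hP : DSmooth P)
    {r₀ : W} {u₀ : U} (h : φ u₀ = P r₀) :
    ∃ L : EuclideanSpace ℝ (Fin k) → EuclideanSpace ℝ (Fin m), L r₀ = u₀ ∧ IsLiftAt φ P L r₀ ∧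
      ∀ L' : EuclideanSpace ℝ (Fin k) → EuclideanSpace ℝ (Fin m), L' r₀ = u₀ →
        IsLiftAt φ P L' r₀ → L' =ᶠ[𝓝 (r₀ : EuclideanSpace ℝ (Fin k))] L := by
  obtain ⟨O, O', hmaps, hO, hO', hx, hfx, -, g, hg, hgl, hgr⟩ := hφ.2 k W P hP ⟨(r₀, u₀), h.symm⟩
  have hfx : r₀ ∈ O' := hfx
  have hN := eventually_mem_of_isDOpen hO' hfx
  obtain ⟨e, e', he, heS, hee⟩ := exists_smooth_retract hN
  choose heW heO using heS
  have hq : IsPlot (fun t => (⟨⟨e t, heW t⟩, heO t⟩ : O')) := by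
    exact he.isPlot
  have hgq := hg.comp hq.dSmooth
  have hsm : ContDiff ℝ ∞ fun t => ((g ⟨⟨e t, heW t⟩, heO t⟩).1.1.2 : EuclideanSpace ℝ (Fin m)) := by
    have h1 : IsPlot fun t => ((g ⟨⟨e t, heW t⟩, heO t⟩).1.1.2 : EuclideanSpace ℝ (Fin m)) :=
      (hg _ _ hq).2
    exact h1.contDiff
  have hg1 : ∀ y : O', (g y).1.1.1 = y.1 := fun y => congrArg Subtype.val (hgr y)
  have key : ∀ (y : O') (p : Pullback φ P), p ∈ O → p.1.1 = y.1 → (g y).1.1.2 = p.1.2 := by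
    intro y p hp hy
    have h1 := hgl ⟨p, hp⟩
    have h2 : hmaps.restrict _ _ _ (⟨p, hp⟩ : O) = y := Subtype.ext hy
    rw [h2] at h1
    rw [h1]
  -- Inserting `e ∘ e'`, the identity near `r₀`, makes the lift a total function.
  refine ⟨fun r => (g ⟨⟨e (e' r), heW _⟩, heO _⟩).1.1.2, ?_, ?_, ?_⟩
  · have h0 := hee.self_of_nhds.2
    have : (⟨⟨e (e' r₀), heW _⟩, heO _⟩ : O') = ⟨r₀, hfx⟩ := Subtype.ext (Subtype.ext h0)
    simp only [this]
    rw [key ⟨r₀, hfx⟩ _ hx rfl]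
  · filter_upwards [hee] with r hr
    refine ⟨hsm.contDiffAt.comp r hr.1, hr.2 ▸ heW _, (g _).1.1.2.2, ?_⟩
    have h1 := (g ⟨⟨e (e' r), heW _⟩, heO _⟩).1.2
    rw [Subtype.coe_eta, ← h1, hg1]
    exact congrArg P (Subtype.ext hr.2)
  · intro L' h0 hL'
    obtain ⟨d, d', hd, hdS, hdd⟩ := exists_smooth_retract hL'
    choose hdc hdW hdU hdφ using hdS
    have hp : IsPlot (fun t => (⟨(⟨d t, hdW t⟩, ⟨L' (d t), hdU t⟩), (hdφ t).symm⟩ :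
        Pullback φ P)) := by
      refine ⟨hd.isPlot, ?_⟩
      change IsPlot fun t => L' (d t)
      refine ContDiff.isPlot ?_
      exact contDiff_iff_contDiffAt.2 fun t => (hdc t).comp t hd.contDiffAt
    have ho := isOpen_iff_preimages_plots.1 hO _ _ hp
    have hd0 := hdd.self_of_nhds
    have hc := hd0.1.continuousAt.eventually_mem (ho.mem_nhds (by
      have : (⟨(⟨d (d' r₀), hdW _⟩, ⟨L' (d (d' r₀)), hdU _⟩), (hdφ _).symm⟩ :
        Pullback φ P) = ⟨(r₀, u₀), h.symm⟩ := by
        refine Subtype.ext (Prod.ext (Subtype.ext hd0.2) (Subtype.ext ?_))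
        simp only [hd0.2, h0]
      rw [Set.mem_preimage, this]
      exact hx))
    filter_upwards [hc, hdd, hee] with r h1 h2 h3
    have h1 : (⟨(⟨d (d' r), hdW _⟩, ⟨L' (d (d' r)), hdU _⟩), (hdφ _).symm⟩ :
        Pullback φ P) ∈ O := h1
    have := key ⟨⟨e (e' r), heW _⟩, heO _⟩ _ h1 (Subtype.ext (h2.2.trans h3.2.symm))
    rw [this]
    simp only [h2.2]

theorem IsLiftAt.eventuallyEq (hφ : IsDiffeologicalEtale φ) (hP : DSmooth P)
    {r₀ : EuclideanSpace ℝ (Fin k)}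
    {L L' : EuclideanSpace ℝ (Fin k) → EuclideanSpace ℝ (Fin m)} (hL : IsLiftAt φ P L r₀)
    (hL' : IsLiftAt φ P L' r₀) (h : L r₀ = L' r₀) : L =ᶠ[𝓝 r₀] L' := by
  obtain ⟨hr, hu, h0⟩ := hL.self_of_nhds.2
  obtain ⟨L₁, -, -, H⟩ := hφ.exists_isLiftAt hP (r₀ := ⟨r₀, hr⟩) h0
  exact (H L rfl hL).trans (H L' h.symm hL').symm

end Lift

/-! ### Smooth one-sided inverses -/

section Inverse

variable {E : Type*} [NormedAddCommGroup E] [NormedSpace ℝ E] [CompleteSpace E]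

/-- Smoothness of order `∞` at one point does not spread to a neighbourhood. The inverse is smooth
near `g a` because `g` is smooth near `a` and invertible operators form an open set. -/
theorem exists_local_inverse {g : E → E} {a : E} (hg : ∀ᶠ x in 𝓝 a, ContDiffAt ℝ ∞ g x)
    (hg' : fderiv ℝ g a = ContinuousLinearMap.id ℝ E) :
    ∃ s : E → E, s (g a) = a ∧ (∀ᶠ y in 𝓝 (g a), ContDiffAt ℝ ∞ s y ∧ g (s y) = y) ∧
      ∀ᶠ x in 𝓝 a, s (g x) = x := by
  have hga := hg.self_of_nhds
  have hd : HasFDerivAt g ((ContinuousLinearEquiv.refl ℝ E : E ≃L[ℝ] E) : E →L[ℝ] E) a := by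
    have := (hga.differentiableAt (by simp)).hasFDerivAt
    rwa [hg'] at this
  let Φ := hga.toOpenPartialHomeomorph _ hd (by simp)
  have hΦ : (Φ : E → E) = g := hga.toOpenPartialHomeomorph_coe hd (by simp)
  have ha : a ∈ Φ.source := hga.mem_toOpenPartialHomeomorph_source hd (by simp)
  have hga' : g a ∈ Φ.target := hΦ ▸ Φ.map_source ha
  have hsa : Φ.symm (g a) = a := hΦ ▸ Φ.left_inv ha
  have hcont : ContinuousAt Φ.symm (g a) := Φ.symm.continuousAt hga'
  have hinv : ∀ᶠ x in 𝓝 a, ∃ f' : E ≃L[ℝ] E, HasFDerivAt g (f' : E →L[ℝ] E) x := by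
    have hc : ContinuousAt (fderiv ℝ g) a :=
      (hga.fderiv_right (m := 0) (by norm_num)).continuousAt
    have := hc.eventually_mem
      (by rw [hg']; exact (ContinuousLinearEquiv.refl ℝ E).nhds)
    filter_upwards [this, hg] with x ⟨f', hf'⟩ hx
    exact ⟨f', hf' ▸ (hx.differentiableAt (by simp)).hasFDerivAt⟩
  refine ⟨Φ.symm, hsa, ?_, ?_⟩
  · have h1 : ∀ᶠ y in 𝓝 (g a), (∃ f' : E ≃L[ℝ] E, HasFDerivAt g (f' : E →L[ℝ] E) (Φ.symm y)) ∧
        ContDiffAt ℝ ∞ g (Φ.symm y) := by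
      have := hinv.and hg
      rw [← hsa] at this
      exact hcont.eventually this
    filter_upwards [h1, Φ.open_target.mem_nhds hga'] with y ⟨⟨f', hf'⟩, hy⟩ hyt
    exact ⟨Φ.contDiffAt_symm hyt (hΦ ▸ hf') (hΦ ▸ hy), hΦ ▸ Φ.right_inv hyt⟩
  · filter_upwards [Φ.open_source.mem_nhds ha] with x hx
    exact hΦ ▸ Φ.left_inv hx

end Inverse

/-- Restrict `g` to the affine slice `a + A v`, with `A` a linear right inverse of the derivative:
the restriction has identity derivative at `0`. -/
theorem exists_local_rightInverse {m n : ℕ}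
    {g : EuclideanSpace ℝ (Fin m) → EuclideanSpace ℝ (Fin n)} {a : EuclideanSpace ℝ (Fin m)}
    (hg : ∀ᶠ x in 𝓝 a, ContDiffAt ℝ ∞ g x) (hg' : Function.Surjective (fderiv ℝ g a)) :
    ∃ s : EuclideanSpace ℝ (Fin n) → EuclideanSpace ℝ (Fin m), s (g a) = a ∧
      ∀ᶠ y in 𝓝 (g a), ContDiffAt ℝ ∞ s y ∧ g (s y) = y := by
  obtain ⟨A, hA⟩ := (fderiv ℝ g a : _ →ₗ[ℝ] _).exists_rightInverse_of_surjective
    (LinearMap.range_eq_top.2 (by exact hg'))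
  let A' := LinearMap.toContinuousLinearMap A
  let j : EuclideanSpace ℝ (Fin n) → EuclideanSpace ℝ (Fin m) := fun v => a + A' v
  have hj : ContDiff ℝ ∞ j := contDiff_const.add A'.contDiff
  have hj0 : j 0 = a := by simp [j]
  have hjd : HasFDerivAt j A' 0 := A'.hasFDerivAt.const_add a
  have hga := hg.self_of_nhds
  obtain ⟨s, hs0, hs, -⟩ := exists_local_inverse (g := g ∘ j) (a := 0) (by
      have : ∀ᶠ v in 𝓝 0, ContDiffAt ℝ ∞ g (j v) :=
        hj.continuous.continuousAt.eventually (by rw [hj0]; exact hg)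
      filter_upwards [this] with v hv
      exact hv.comp v hj.contDiffAt) (by
      have h1 : HasFDerivAt g (fderiv ℝ g a) (j 0) := by
        rw [hj0]; exact (hga.differentiableAt (by simp)).hasFDerivAt
      rw [(h1.comp 0 hjd).fderiv]
      ext1 v
      exact LinearMap.congr_fun hA v)
  have hga0 : (g ∘ j) 0 = g a := congrArg g hj0
  rw [hga0] at hs0 hs
  refine ⟨j ∘ s, by simp [hs0, hj0], ?_⟩
  filter_upwards [hs] with y hy
  exact ⟨hj.contDiffAt.comp y hy.1, hy.2⟩

/-- Compose `g` with a linear left inverse `B` of its derivative: `B ∘ g` has identity derivative at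
`a`. -/
theorem exists_local_leftInverse {m n : ℕ}
    {g : EuclideanSpace ℝ (Fin m) → EuclideanSpace ℝ (Fin n)} {a : EuclideanSpace ℝ (Fin m)}
    (hg : ∀ᶠ x in 𝓝 a, ContDiffAt ℝ ∞ g x) (hg' : Function.Injective (fderiv ℝ g a)) :
    ∃ s : EuclideanSpace ℝ (Fin n) → EuclideanSpace ℝ (Fin m), s (g a) = a ∧
      (∀ᶠ y in 𝓝 (g a), ContDiffAt ℝ ∞ s y) ∧ ∀ᶠ x in 𝓝 a, s (g x) = x := by
  obtain ⟨B, hB⟩ := (fderiv ℝ g a : _ →ₗ[ℝ] _).exists_leftInverse_of_injective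
    (LinearMap.ker_eq_bot.2 (by exact hg'))
  let B' := LinearMap.toContinuousLinearMap B
  have hga := hg.self_of_nhds
  obtain ⟨s, hs0, hs, hsl⟩ := exists_local_inverse (g := B' ∘ g) (a := a) (by
      filter_upwards [hg] with v hv
      exact B'.contDiff.contDiffAt.comp v hv) (by
      rw [(B'.hasFDerivAt.comp a (hga.differentiableAt (by simp)).hasFDerivAt).fderiv]
      ext1 v
      exact LinearMap.congr_fun hB v)
  refine ⟨s ∘ B', hs0, ?_, hsl⟩
  filter_upwards [B'.continuous.continuousAt.eventually hs] with y hy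
  exact hy.1.comp y B'.contDiff.contDiffAt

/-! ### Tangent spaces of étale manifolds -/

/-- The étale map `φ`, translated to a plot centered at `x = φ u₀`. -/
@[reducible]
def chartPlot {X : Type u} [DiffeologicalSpace X] {m : ℕ} {U : Opens (EuclideanSpace ℝ (Fin m))}
    {φ : U → X} (hφ : DSmooth φ) (u₀ : U) {x : X} (h : φ u₀ = x) : CenteredPlot X x where
  dim := m
  dom := ⟨(fun v => u₀ + v) ⁻¹' U, U.isOpen.preimage (continuous_const.add continuous_id)⟩
  zero_mem := by
    change (u₀ + 0 : EuclideanSpace ℝ (Fin m)) ∈ U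
    rw [add_zero]; exact u₀.2
  toFun v := φ ⟨u₀ + v, v.2⟩
  smooth := by
    intro k p hp
    have hp' : IsPlot fun t => (p t : EuclideanSpace ℝ (Fin m)) := hp
    refine hφ k (fun t => ⟨u₀ + p t, (p t).2⟩) ?_
    exact (contDiff_const.add hp'.contDiff).isPlot
  map_zero := by
    rw [← h]
    exact congrArg φ (Subtype.ext (add_zero _))

section

variable {X : Type u} [DiffeologicalSpace X] {m : ℕ} {U : Opens (EuclideanSpace ℝ (Fin m))}
  {φ : U → X} {u₀ : U} {x : X}

theorem CenteredPlot.exists_isLiftAt (hφ : IsDiffeologicalEtale φ) (h : φ u₀ = x)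
    (P : CenteredPlot X x) :
    ∃ L : EuclideanSpace ℝ (Fin P.dim) → EuclideanSpace ℝ (Fin m),
      L 0 = u₀ ∧ IsLiftAt φ P.toFun L 0 := by
  obtain ⟨L, h0, hL, -⟩ := hφ.exists_isLiftAt P.smooth (r₀ := ⟨0, P.zero_mem⟩) (u₀ := u₀)
    (h.trans P.map_zero.symm)
  exact ⟨L, h0, hL⟩

theorem IsLiftAt.isPlotMorphism (hφ : DSmooth φ) (h : φ u₀ = x) {P : CenteredPlot X x}
    {L : EuclideanSpace ℝ (Fin P.dim) → EuclideanSpace ℝ (Fin m)} (h0 : L 0 = u₀)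
    (hL : IsLiftAt φ P.toFun L 0) :
    IsPlotMorphism P (chartPlot hφ u₀ h) fun v => L v - u₀ := by
  refine ⟨by simp [h0], ?_⟩
  obtain ⟨W, hW, hWo, hW0⟩ := eventually_nhds_iff.1 hL
  refine ⟨⟨W, hWo⟩, hW0, fun r hr => ((hW r hr).1.sub contDiffAt_const).contDiffWithinAt, ?_⟩
  intro r hr
  obtain ⟨-, hP, hU, e⟩ := hW r hr
  have e' : (u₀ + (L r - u₀) : EuclideanSpace ℝ (Fin m)) = L r := add_sub_cancel _ _
  refine ⟨hP, ?_, e.symm.trans ?_⟩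
  · change (u₀ + (L r - u₀) : EuclideanSpace ℝ (Fin m)) ∈ U
    rwa [e']
  · exact congrArg φ (Subtype.ext e'.symm)

theorem IsLiftAt.dPlot_eq (hφ : DSmooth φ) (h : φ u₀ = x) {P : CenteredPlot X x}
    {L : EuclideanSpace ℝ (Fin P.dim) → EuclideanSpace ℝ (Fin m)} (h0 : L 0 = u₀)
    (hL : IsLiftAt φ P.toFun L 0) (v : EuclideanSpace ℝ (Fin P.dim)) :
    dPlot P v = dPlot (chartPlot hφ u₀ h) (fderiv ℝ L 0 v) := by
  rw [← dPlot_comp (hL.isPlotMorphism hφ h h0) v, fderiv_sub_const]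

theorem dPlot_chartPlot_surjective (hφ : IsDiffeologicalEtale φ) (h : φ u₀ = x) :
    Function.Surjective (dPlot (chartPlot hφ.1 u₀ h)) := by
  classical
  rw [← LinearMap.range_eq_top, eq_top_iff]
  rintro z -
  obtain ⟨z, rfl⟩ := (plotRel X x).mkQ_surjective z
  induction z using DirectSum.induction_on with
  | zero => rw [map_zero]; exact Submodule.zero_mem _
  | add a b ha hb => rw [map_add]; exact Submodule.add_mem _ ha hb
  | of P v =>
    obtain ⟨L, h0, hL⟩ := P.exists_isLiftAt hφ h
    exact ⟨_, (hL.dPlot_eq hφ.1 h h0 v).symm⟩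

/-- The derivatives at `0` of chosen lifts of all centered plots form a cocone, and the induced map
`Ψ` on the tangent space is a left inverse. -/
theorem dPlot_chartPlot_injective (hφ : IsDiffeologicalEtale φ) (h : φ u₀ = x) :
    Function.Injective (dPlot (chartPlot hφ.1 u₀ h)) := by
  classical
  choose L h0 hL using fun P : CenteredPlot X x => P.exists_isLiftAt hφ h
  let Ψ : PlotSum X x →ₗ[ℝ] EuclideanSpace ℝ (Fin m) :=
    DirectSum.toModule ℝ (CenteredPlot X x) (EuclideanSpace ℝ (Fin m))
      fun P => (fderiv ℝ (L P) 0 : EuclideanSpace ℝ (Fin P.dim) →ₗ[ℝ] EuclideanSpace ℝ (Fin m))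
  have hΨ : ∀ (P : CenteredPlot X x) v, Ψ (plotIncl P v) = fderiv ℝ (L P) 0 v := by
    intro P v
    unfold plotIncl
    exact DirectSum.toModule_lof (M := fun P : CenteredPlot X x => EuclideanSpace ℝ (Fin P.dim))
      ℝ P v
  have hker : plotRel X x ≤ LinearMap.ker Ψ := by
    refine Submodule.span_le.2 ?_
    rintro _ ⟨Q, P, F, v, ⟨hF0, W, hW0, hFW, hF⟩, rfl⟩
    rw [SetLike.mem_coe, LinearMap.mem_ker, map_sub, hΨ, hΨ, sub_eq_zero]
    have hW := W.isOpen.mem_nhds hW0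
    have hFd : ContDiffAt ℝ ∞ F 0 := hFW.contDiffAt hW
    -- Compatibility with a morphism `F`: both `L P ∘ F` and `L Q` lift `Q`, so their germs agree
    -- and the chain rule applies.
    have hlift : IsLiftAt φ Q.toFun (L P ∘ F) 0 := by
      have := hFd.continuousAt.eventually (p := fun r => ContDiffAt ℝ ∞ (L P) r ∧
        ∃ (hr : r ∈ P.dom) (hu : L P r ∈ U), φ ⟨L P r, hu⟩ = P.toFun ⟨r, hr⟩)
        (by rw [hF0]; exact hL P)
      filter_upwards [this, hW] with r ⟨hr, hP, hu, e⟩ hrW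
      obtain ⟨hQ, hP', e'⟩ := hF r hrW
      exact ⟨hr.comp r (hFW.contDiffAt (W.isOpen.mem_nhds hrW)), hQ, hu, e.trans e'.symm⟩
    have heq := (hL Q).eventuallyEq hφ Q.smooth hlift (by simp [hF0, h0])
    have hLd : DifferentiableAt ℝ (L P) (F 0) := by
      rw [hF0]; exact (hL P).self_of_nhds.1.differentiableAt (by simp)
    rw [heq.fderiv_eq, fderiv_comp 0 hLd (hFd.differentiableAt (by simp)), hF0]
    rfl
  -- The centered chart lifts through `φ` by a translation, whose derivative is the identity.
  have hlift : IsLiftAt φ (chartPlot hφ.1 u₀ h).toFun (fun v => u₀ + v) 0 := by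
    filter_upwards [(chartPlot hφ.1 u₀ h).dom.isOpen.mem_nhds (chartPlot hφ.1 u₀ h).zero_mem]
      with r hr
    exact ⟨contDiffAt_const.add contDiffAt_id, hr, hr, rfl⟩
  have heq := (hL (chartPlot hφ.1 u₀ h)).eventuallyEq hφ (chartPlot hφ.1 u₀ h).smooth hlift
    (by rw [h0, add_zero])
  intro v w hvw
  have := congrArg ((plotRel X x).liftQ Ψ hker) hvw
  have hL' : ∀ v, (plotRel X x).liftQ Ψ hker (dPlot (chartPlot hφ.1 u₀ h) v) = v := by
    intro v
    refine (hΨ _ v).trans ?_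
    rw [heq.fderiv_eq, fderiv_const_add, fderiv_fun_id]
    rfl
  rwa [hL', hL'] at this

end

/-! ### Tangent maps in étale charts. -/

section

variable {X : Type u} {Y : Type v} [DiffeologicalSpace X] [DiffeologicalSpace Y] {m n : ℕ}
  {U : Opens (EuclideanSpace ℝ (Fin m))} {V : Opens (EuclideanSpace ℝ (Fin n))}
  {φ : U → X} {ψ : V → Y} {f : X → Y}

theorem tangentMap_chartPlot (hφ : IsDiffeologicalEtale φ) (hψ : IsDiffeologicalEtale ψ)
    (hf : DSmooth f) {u₀ : U} {v₀ : V} (h : ψ v₀ = f (φ u₀))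
    {F : EuclideanSpace ℝ (Fin m) → EuclideanSpace ℝ (Fin n)} (hF0 : F u₀ = v₀)
    (hF : IsLiftAt ψ (f ∘ φ) F u₀) (v : EuclideanSpace ℝ (Fin m)) :
    tangentMap hf (φ u₀) (dPlot (chartPlot hφ.1 u₀ rfl) v) =
      dPlot (chartPlot hψ.1 v₀ h) (fderiv ℝ F u₀ v) := by
  rw [tangentMap_dPlot]
  have hlift : IsLiftAt ψ ((chartPlot hφ.1 u₀ rfl).map hf).toFun
      (fun v : EuclideanSpace ℝ (Fin m) => F (u₀ + v)) (0 : EuclideanSpace ℝ (Fin m)) := by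
    have hc : ContinuousAt (fun v : EuclideanSpace ℝ (Fin m) => u₀ + v) 0 := by fun_prop
    have := hc.eventually (p := fun r => ContDiffAt ℝ ∞ F r ∧
      ∃ (hr : r ∈ U) (hu : F r ∈ V), ψ ⟨F r, hu⟩ = (f ∘ φ) ⟨r, hr⟩)
      (by simp only [add_zero]; exact hF)
    filter_upwards [this] with r ⟨h1, h2, h3, h4⟩
    exact ⟨h1.comp r (contDiffAt_const.add contDiffAt_id), h2, h3, h4⟩
  have h0 : F ((u₀ : EuclideanSpace ℝ (Fin m)) + 0) = v₀ := by rw [add_zero, hF0]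
  have hd : fderiv ℝ (fun v : EuclideanSpace ℝ (Fin m) => F (u₀ + v)) 0 = fderiv ℝ F u₀ := by
    rw [fderiv_comp_add_left, add_zero]
  exact (hlift.dPlot_eq hψ.1 h h0 v).trans
    (congrArg (fun T : EuclideanSpace ℝ (Fin m) →L[ℝ] EuclideanSpace ℝ (Fin n) =>
      dPlot (chartPlot hψ.1 v₀ h) (T v)) hd)

theorem fderiv_injective_of_tangentMap (hφ : IsDiffeologicalEtale φ)
    (hψ : IsDiffeologicalEtale ψ) (hf : DSmooth f) {u₀ : U} {v₀ : V} (h : ψ v₀ = f (φ u₀))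
    {F : EuclideanSpace ℝ (Fin m) → EuclideanSpace ℝ (Fin n)} (hF0 : F u₀ = v₀)
    (hF : IsLiftAt ψ (f ∘ φ) F u₀) (hinj : Function.Injective (tangentMap hf (φ u₀))) :
    Function.Injective (fderiv ℝ F u₀) := by
  refine Function.Injective.of_comp (f := dPlot (chartPlot hψ.1 v₀ h)) ?_
  have : dPlot (chartPlot hψ.1 v₀ h) ∘ fderiv ℝ F u₀ =
      tangentMap hf (φ u₀) ∘ dPlot (chartPlot hφ.1 u₀ rfl) :=
    funext fun v => (tangentMap_chartPlot hφ hψ hf h hF0 hF v).symm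
  rw [this]
  exact hinj.comp (dPlot_chartPlot_injective hφ rfl)

theorem fderiv_surjective_of_tangentMap (hφ : IsDiffeologicalEtale φ)
    (hψ : IsDiffeologicalEtale ψ) (hf : DSmooth f) {u₀ : U} {v₀ : V} (h : ψ v₀ = f (φ u₀))
    {F : EuclideanSpace ℝ (Fin m) → EuclideanSpace ℝ (Fin n)} (hF0 : F u₀ = v₀)
    (hF : IsLiftAt ψ (f ∘ φ) F u₀) (hsurj : Function.Surjective (tangentMap hf (φ u₀))) :
    Function.Surjective (fderiv ℝ F u₀) := by
  refine Function.Surjective.of_comp_left (f := dPlot (chartPlot hψ.1 v₀ h)) ?_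
    (dPlot_chartPlot_injective hψ h)
  have : dPlot (chartPlot hψ.1 v₀ h) ∘ fderiv ℝ F u₀ =
      tangentMap hf (φ u₀) ∘ dPlot (chartPlot hφ.1 u₀ rfl) :=
    funext fun v => (tangentMap_chartPlot hφ hψ hf h hF0 hF v).symm
  rw [this]
  exact hsurj.comp (dPlot_chartPlot_surjective hφ rfl)

/-- A smooth map of étale manifolds has a smooth local representative in étale charts through any
given point. -/
theorem IsEtaleManifold.exists_local_rep (hX : IsEtaleManifold m X) (hY : IsEtaleManifold n Y)
    (hf : DSmooth f) (x : X) :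
    ∃ (U : Opens (EuclideanSpace ℝ (Fin m))) (φ : U → X) (u₀ : U)
      (V : Opens (EuclideanSpace ℝ (Fin n))) (ψ : V → Y) (v₀ : V)
      (F : EuclideanSpace ℝ (Fin m) → EuclideanSpace ℝ (Fin n)),
      IsDiffeologicalEtale φ ∧ IsDiffeologicalEtale ψ ∧ φ u₀ = x ∧ ψ v₀ = f x ∧ F u₀ = v₀ ∧
        IsLiftAt ψ (f ∘ φ) F u₀ := by
  obtain ⟨A, hA, hAc⟩ := hX
  obtain ⟨B, hB, hBc⟩ := hY
  obtain ⟨⟨U, φ⟩, hφA, u₀, hu₀⟩ := hAc x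
  obtain ⟨⟨V, ψ⟩, hψB, v₀, hv₀⟩ := hBc (f x)
  have hφ := hA _ hφA
  have hψ := hB _ hψB
  obtain ⟨F, hF0, hF, -⟩ := hψ.exists_isLiftAt (hf.comp hφ.1) (r₀ := u₀) (u₀ := v₀)
    (hv₀.trans (congrArg f hu₀.symm))
  exact ⟨U, φ, u₀, V, ψ, v₀, F, hφ, hψ, hu₀, hv₀, hF0, hF⟩

end

/-! ### Maps with surjective, injective or bijective tangent maps -/

/-- Near `r₀`, `f (φ (s (L r))) = ψ (F (s (L r))) = ψ (L r) = P r`. -/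
theorem IsLiftAt.comp_rightInverse {X : Type u} {Y : Type v} {m n k : ℕ}
    {U : Opens (EuclideanSpace ℝ (Fin m))} {V : Opens (EuclideanSpace ℝ (Fin n))}
    {W : Opens (EuclideanSpace ℝ (Fin k))} {φ : U → X} {ψ : V → Y} {f : X → Y} {P : W → Y}
    {F : EuclideanSpace ℝ (Fin m) → EuclideanSpace ℝ (Fin n)}
    {L : EuclideanSpace ℝ (Fin k) → EuclideanSpace ℝ (Fin n)} {u₀ : EuclideanSpace ℝ (Fin m)}
    {r₀ : EuclideanSpace ℝ (Fin k)} {s : EuclideanSpace ℝ (Fin n) → EuclideanSpace ℝ (Fin m)}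
    (hF : IsLiftAt ψ (f ∘ φ) F u₀) (hL : IsLiftAt ψ P L r₀) (hLF : L r₀ = F u₀)
    (hs0 : s (F u₀) = u₀) (hs : ∀ᶠ v in 𝓝 (F u₀), ContDiffAt ℝ ∞ s v ∧ F (s v) = v) :
    IsLiftAt (f ∘ φ) P (s ∘ L) r₀ := by
  have hLc : ContinuousAt L r₀ := hL.self_of_nhds.1.continuousAt
  have h1 := hLc.eventually (by rw [hLF]; exact hs)
  have hsc : ContinuousAt s (L r₀) := by rw [hLF]; exact hs.self_of_nhds.1.continuousAt
  have h2 := (hsc.comp hLc).eventually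
    (by simp only [Function.comp, hLF, hs0]; exact hF)
  filter_upwards [hL, h1, h2] with r ⟨hLr, hW, hV, e⟩ ⟨hsr, hFs⟩ ⟨_, hU, hFV, e'⟩
  refine ⟨hsr.comp r hLr, hW, hU, e'.symm.trans ?_⟩
  rw [← e]
  exact congrArg ψ (Subtype.ext hFs)

/-! ### Points of the pullback matched by local representatives. -/

section

variable {X : Type u} {Y : Type v} [DiffeologicalSpace X] [DiffeologicalSpace Y] {m n k : ℕ}
  {U : Opens (EuclideanSpace ℝ (Fin m))} {V : Opens (EuclideanSpace ℝ (Fin n))}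
  {W : Opens (EuclideanSpace ℝ (Fin k))} {φ : U → X} {ψ : V → Y} {f : X → Y} {P : W → Y}
  {F : EuclideanSpace ℝ (Fin m) → EuclideanSpace ℝ (Fin n)}
  {L : EuclideanSpace ℝ (Fin k) → EuclideanSpace ℝ (Fin n)}

theorem isPlot_comp_of_contDiffAt (hφ : DSmooth φ)
    {K : EuclideanSpace ℝ (Fin k) → EuclideanSpace ℝ (Fin m)} {j : ℕ}
    {p : EuclideanSpace ℝ (Fin j) → EuclideanSpace ℝ (Fin k)} (hp : IsPlot p)
    (hK : ∀ t, ContDiffAt ℝ ∞ K (p t)) (hU : ∀ t, K (p t) ∈ U) :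
    IsPlot fun t => φ ⟨K (p t), hU t⟩ := by
  refine hφ j (fun t => ⟨K (p t), hU t⟩) ?_
  change IsPlot fun t => K (p t)
  exact (contDiff_iff_contDiffAt.2 fun t => (hK t).comp t hp.contDiff.contDiffAt).isPlot

/-- The part of `P^*X` on which points are matched by the local representatives `F` of `f` and `L`
of `P`. -/
def matchedSet (f : X → Y) (φ : U → X) (P : W → Y)
    (F : EuclideanSpace ℝ (Fin m) → EuclideanSpace ℝ (Fin n))
    (L : EuclideanSpace ℝ (Fin k) → EuclideanSpace ℝ (Fin n))
    (A : Set (EuclideanSpace ℝ (Fin m))) (B : Set (EuclideanSpace ℝ (Fin k))) :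
    Set (Pullback f P) :=
  {p | ∃ (u : EuclideanSpace ℝ (Fin m)) (hu : u ∈ U), u ∈ A ∧ φ ⟨u, hu⟩ = p.1.2 ∧
    (p.1.1 : EuclideanSpace ℝ (Fin k)) ∈ B ∧ F u = L p.1.1}

/-- Along a plot `t ↦ (r, x)` of `P^*X`, lift `x` through `φ` to `G`. Then `F ∘ G` and `L ∘ r` both
lift `f ∘ x = P ∘ r` through `ψ`; agreeing at `t₀`, they agree nearby. -/
theorem isDOpen_matchedSet (hφ : IsDiffeologicalEtale φ) (hψ : IsDiffeologicalEtale ψ)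
    (hf : DSmooth f) {A : Set (EuclideanSpace ℝ (Fin m))} {B : Set (EuclideanSpace ℝ (Fin k))}
    (hAo : IsOpen A) (hBo : IsOpen B) (hA : ∀ u ∈ A, IsLiftAt ψ (f ∘ φ) F u)
    (hB : ∀ r ∈ B, IsLiftAt ψ P L r) : IsDOpen (matchedSet f φ P F L A B) := by
  refine isDOpen_of_eventually_isPlot fun j p hp t₀ ht₀ => ?_
  obtain ⟨u, hu, huA, hux, hrB, hFL⟩ := ht₀
  have hr : ContDiff ℝ ∞ fun t => ((p t).1.1 : EuclideanSpace ℝ (Fin k)) := by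
    have h : IsPlot fun t => ((p t).1.1 : EuclideanSpace ℝ (Fin k)) := hp.1
    exact h.contDiff
  have hx : IsPlot fun t => (p t).1.2 := hp.2
  let x : (⊤ : Opens (EuclideanSpace ℝ (Fin j))) → X := fun t => (p t).1.2
  have hxs : DSmooth x := fun _ q hq => hx.dSmooth _ _ (isPlot_subtype_val.1 hq)
  obtain ⟨G, hG0, hG, -⟩ := hφ.exists_isLiftAt hxs (r₀ := ⟨t₀, trivial⟩) (u₀ := ⟨u, hu⟩) hux
  have hG0 : G t₀ = u := hG0
  have hGc : ContinuousAt G t₀ := hG.self_of_nhds.1.continuousAt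
  have h1 : IsLiftAt ψ (f ∘ x) (F ∘ G) t₀ := by
    have := hGc.eventually (by rw [hG0]; exact hA u huA)
    filter_upwards [this, hG] with t ⟨hFt, hGU, hFV, e⟩ ⟨hGt, _, hGU', e'⟩
    exact ⟨hFt.comp t hGt, trivial, hFV, e.trans (congrArg f e')⟩
  have h2 : IsLiftAt ψ (f ∘ x) (fun t => L (p t).1.1) t₀ := by
    have := hr.continuous.continuousAt.eventually (hB _ hrB)
    filter_upwards [this] with t ⟨hLt, hW, hLV, e⟩
    exact ⟨hLt.comp t hr.contDiffAt, trivial, hLV, e.trans (p t).2⟩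
  have heq := h1.eventuallyEq hψ (hf.comp hxs) h2 (by simp only [Function.comp, hG0]; exact hFL)
  filter_upwards [heq, hG, hGc.eventually_mem (hAo.mem_nhds (by rwa [hG0])),
    hr.continuous.continuousAt.eventually_mem (hBo.mem_nhds hrB)] with t ht ⟨_, _, hGU, e⟩ hGA hrB
  exact ⟨G t, hGU, hGA, e, hrB, ht⟩

end

/-! ### The three conclusions for étale manifolds. -/

variable {M : Type u} {N : Type v} [DiffeologicalSpace M] [DiffeologicalSpace N] {m n : ℕ}

theorem isDiffeologicalSubmersion_of_tangentMap_surjective (hM : IsEtaleManifold m M)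
    (hN : IsEtaleManifold n N) {f : M → N} (hf : DSmooth f)
    (hd : ∀ x : M, Function.Surjective (tangentMap hf x)) : IsDiffeologicalSubmersion f := by
  refine ⟨hf, fun k W P hP => ⟨dSmooth_pullbackMap f P, ?_⟩⟩
  rintro ⟨⟨r₀, x₀⟩, hrx⟩
  obtain ⟨U, φ, u₀, V, ψ, v₀, F, hφ, hψ, rfl, hv₀, hF0, hF⟩ := hM.exists_local_rep hN hf x₀
  obtain ⟨L, hL0, hL, -⟩ := hψ.exists_isLiftAt hP (r₀ := r₀) (u₀ := v₀) (hv₀.trans hrx.symm)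
  obtain ⟨s, hs0, hs⟩ := exists_local_rightInverse (hF.mono fun _ h => h.1)
    (fderiv_surjective_of_tangentMap hφ hψ hf hv₀ hF0 hF (hd _))
  have hsL : IsLiftAt (f ∘ φ) P (s ∘ L) r₀ :=
    hF.comp_rightInverse hL (hL0.trans hF0.symm) hs0 hs
  obtain ⟨B, hB, hBo, hB0⟩ := eventually_nhds_iff.1 hsL
  choose hBc hBW hBU hBe using hB
  refine ⟨Subtype.val ⁻¹' B, isDOpen_of_isOpen hBo,
    fun y => ⟨(y.1, φ ⟨s (L y.1), hBU _ y.2⟩), (hBe _ y.2).symm⟩, ?_, fun y => rfl,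
    ⟨⟨r₀, hB0⟩, ?_⟩⟩
  · intro j p hp
    exact ⟨hp, isPlot_comp_of_contDiffAt hφ.1 (K := s ∘ L) (isPlot_subtype_val.1 hp)
      (fun t => hBc _ (p t).2) (fun t => hBU _ (p t).2)⟩
  · refine Subtype.ext (Prod.ext rfl (congrArg φ (Subtype.ext ?_)))
    change s (L r₀) = u₀
    rw [hL0, ← hF0, hs0]

/-- If `f` has injective tangent maps, then around any given point of `P^*M` there are local
representatives `F` of `f` and `L` of `P`, and a smooth local left inverse `s` of `F`. -/
theorem exists_local_leftInverse_of_tangentMap_injective (hM : IsEtaleManifold m M)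
    (hN : IsEtaleManifold n N) {f : M → N} (hf : DSmooth f)
    (hd : ∀ x : M, Function.Injective (tangentMap hf x)) {k : ℕ}
    {W : Opens (EuclideanSpace ℝ (Fin k))} {P : W → N} (hP : DSmooth P) (p₀ : Pullback f P) :
    ∃ (U : Opens (EuclideanSpace ℝ (Fin m))) (φ : U → M)
      (F : EuclideanSpace ℝ (Fin m) → EuclideanSpace ℝ (Fin n))
      (L : EuclideanSpace ℝ (Fin k) → EuclideanSpace ℝ (Fin n))
      (s : EuclideanSpace ℝ (Fin n) → EuclideanSpace ℝ (Fin m))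
      (A : Set (EuclideanSpace ℝ (Fin m))) (B : Set (EuclideanSpace ℝ (Fin k))),
      DSmooth φ ∧ IsOpen B ∧ ↑p₀.1.1 ∈ B ∧
      (∀ B' ⊆ B, IsOpen B' → IsDOpen (matchedSet f φ P F L A B')) ∧
      (∀ B', ↑p₀.1.1 ∈ B' → p₀ ∈ matchedSet f φ P F L A B') ∧
      (∀ u ∈ A, s (F u) = u) ∧
      (∀ r ∈ B, ContDiffAt ℝ ∞ (s ∘ L) r ∧ s (L r) ∈ U) ∧
      ((∀ x : M, Function.Surjective (tangentMap hf x)) →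
        IsLiftAt (f ∘ φ) P (s ∘ L) p₀.1.1 ∧
        ∀ᶠ r in 𝓝 (p₀.1.1 : EuclideanSpace ℝ (Fin k)), s (L r) ∈ A ∧ F (s (L r)) = L r) := by
  obtain ⟨⟨r₀, x₀⟩, hrx⟩ := p₀
  obtain ⟨U, φ, u₀, V, ψ, v₀, F, hφ, hψ, rfl, hv₀, hF0, hF⟩ := hM.exists_local_rep hN hf x₀
  obtain ⟨L, hL0, hL, -⟩ := hψ.exists_isLiftAt hP (r₀ := r₀) (u₀ := v₀) (hv₀.trans hrx.symm)
  have hFc : ∀ᶠ u in 𝓝 (u₀ : EuclideanSpace ℝ (Fin m)), ContDiffAt ℝ ∞ F u :=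
    hF.mono fun _ h => h.1
  obtain ⟨s, hs0, hs, hsF⟩ := exists_local_leftInverse hFc
    (fderiv_injective_of_tangentMap hφ hψ hf hv₀ hF0 hF (hd _))
  have hLF : L r₀ = F u₀ := hL0.trans hF0.symm
  have hLc : ContinuousAt L r₀ := hL.self_of_nhds.1.continuousAt
  have hsc : ContinuousAt s (F u₀) := hs.self_of_nhds.continuousAt
  have hsLc : Filter.Tendsto (fun r => s (L r)) (𝓝 (r₀ : EuclideanSpace ℝ (Fin k)))
      (𝓝 (u₀ : EuclideanSpace ℝ (Fin m))) := by
    have h1 : Filter.Tendsto L (𝓝 (r₀ : EuclideanSpace ℝ (Fin k))) (𝓝 (F u₀)) := hLF ▸ hLc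
    have h2 : Filter.Tendsto s (𝓝 (F u₀)) (𝓝 (u₀ : EuclideanSpace ℝ (Fin m))) := by
      have := hsc.tendsto
      rwa [hs0] at this
    exact h2.comp h1
  -- The lift property is required around every point of `A`, not only around `u₀`, because
  -- D-openness of the matched set is checked at each of its points.
  obtain ⟨A, hA, hAo, hA0⟩ := eventually_nhds_iff.1 ((eventually_eventually_nhds.2 hF).and hsF)
  have hsL : ∀ᶠ r in 𝓝 (r₀ : EuclideanSpace ℝ (Fin k)), ContDiffAt ℝ ∞ s (L r) :=
    hLc.eventually (by rw [hLF]; exact hs)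
  obtain ⟨B, hB, hBo, hB0⟩ := eventually_nhds_iff.1 ((eventually_eventually_nhds.2 hL).and
    (hsL.and (hsLc.eventually_mem (U.isOpen.mem_nhds u₀.2))))
  refine ⟨U, φ, F, L, s, A, B, hφ.1, hBo, hB0, fun B' hB' hBo' => ?_, fun B' hr₀ => ?_,
    fun u hu => (hA u hu).2, fun r hr => ?_, fun hsurj => ?_⟩
  · exact isDOpen_matchedSet hφ hψ hf hAo hBo' (fun u hu => (hA u hu).1)
      fun r hr => (hB r (hB' hr)).1
  · exact ⟨u₀, u₀.2, hA0, rfl, hr₀, hLF.symm⟩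
  · obtain ⟨h1, h2, h3⟩ := hB r hr
    exact ⟨h2.comp r h1.self_of_nhds.1, h3⟩
  · obtain ⟨s', hs0', hs'⟩ := exists_local_rightInverse hFc
      (fderiv_surjective_of_tangentMap hφ hψ hf hv₀ hF0 hF (hsurj _))
    have hsc' : Filter.Tendsto s' (𝓝 (F u₀)) (𝓝 (u₀ : EuclideanSpace ℝ (Fin m))) := by
      have := hs'.self_of_nhds.1.continuousAt.tendsto
      rwa [hs0'] at this
    have hFs : ∀ᶠ v in 𝓝 (F u₀), ContDiffAt ℝ ∞ s v ∧ F (s v) = v := by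
      -- The left and right inverses coincide near `F u₀`: `s v = s (F (s' v)) = s' v`.
      filter_upwards [hs, hs', hsc'.eventually hsF] with v h1 h2 h3
      rw [h2.2] at h3
      exact ⟨h1, by rw [h3, h2.2]⟩
    refine ⟨hF.comp_rightInverse hL hLF hs0 hFs, ?_⟩
    have hFs' : ∀ᶠ r in 𝓝 (r₀ : EuclideanSpace ℝ (Fin k)), F (s (L r)) = L r :=
      hLc.eventually (by rw [hLF]; exact hFs.mono fun _ h => h.2)
    exact (hsLc.eventually_mem (hAo.mem_nhds hA0)).and hFs'

/-- On the matched set `x = φ u` with `u = s (F u) = s (L r)`, so `r ↦ (r, φ (s (L r)))` recovers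
the point. Away from `P^*f (O)` its values need not lie in `P^*M`. -/
theorem isDiffeologicalImmersion_of_tangentMap_injective (hM : IsEtaleManifold m M)
    (hN : IsEtaleManifold n N) {f : M → N} (hf : DSmooth f)
    (hd : ∀ x : M, Function.Injective (tangentMap hf x)) : IsDiffeologicalImmersion f := by
  refine ⟨hf, fun k W P hP p₀ => ?_⟩
  obtain ⟨U, φ, F, L, s, A, B, hφ, hBo, hB0, hD, hp₀, hsF, hsL, -⟩ :=
    exists_local_leftInverse_of_tangentMap_injective hM hN hf hd hP p₀
  refine ⟨matchedSet f φ P F L A B, hD B subset_rfl hBo, hp₀ B hB0, Subtype.val ⁻¹' B, ?_,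
    hBo.preimage continuous_subtype_val, fun r => (r.1, φ ⟨s (L r.1), (hsL _ r.2).2⟩), ?_, ?_⟩
  · rintro p ⟨u, hu, huA, hux, hr, -⟩
    exact hr
  · intro j p hp
    exact ⟨hp, isPlot_comp_of_contDiffAt hφ (K := s ∘ L) (isPlot_subtype_val.1 hp)
      (fun t => (hsL _ (p t).2).1) (fun t => (hsL _ (p t).2).2)⟩
  · rintro p ⟨u, hu, huA, hux, hr, hFL⟩
    refine Prod.ext rfl (Eq.trans (congrArg φ (Subtype.ext ?_)) hux)
    change s (L p.1.1) = u
    rw [← hFL, hsF u huA]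

theorem isDiffeologicalEtale_of_tangentMap_bijective (hM : IsEtaleManifold m M)
    (hN : IsEtaleManifold n N) {f : M → N} (hf : DSmooth f)
    (hd : ∀ x : M, Function.Bijective (tangentMap hf x)) : IsDiffeologicalEtale f := by
  refine ⟨hf, fun k W P hP p₀ => ?_⟩
  obtain ⟨U, φ, F, L, s, A, B, hφ, hBo, hB0, hD, hp₀, hsF, hsL, hsurj⟩ :=
    exists_local_leftInverse_of_tangentMap_injective hM hN hf (fun x => (hd x).1) hP p₀
  obtain ⟨hlift, hAF⟩ := hsurj fun x => (hd x).2
  -- Shrinking to `B'` forces `r ↦ (r, φ (s (L r)))` to take values in the matched set, with `u = s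
  -- (L r)` as witness; it is then a two-sided inverse of the projection.
  obtain ⟨B', hB', hBo', hB0'⟩ := eventually_nhds_iff.1
    ((hlift.and hAF).and (hBo.mem_nhds hB0))
  have hPf : ∀ (r : W) (hr : ↑r ∈ B'), P r = f (φ ⟨s (L r), (hsL r (hB' r hr).2).2⟩) := by
    intro r hr
    obtain ⟨_, _, _, e⟩ := (hB' r hr).1.1
    exact e.symm
  have hmaps : Set.MapsTo (pullbackMap f P) (matchedSet f φ P F L A B')
      (Subtype.val ⁻¹' B') := by
    rintro p ⟨u, hu, huA, hux, hr, -⟩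
    exact hr
  refine ⟨matchedSet f φ P F L A B', Subtype.val ⁻¹' B', hmaps, hD B' (fun r hr => (hB' r hr).2) hBo',
    isDOpen_of_isOpen hBo', hp₀ B' hB0', hB0', fun j p hp => ?_,
    fun r => ⟨⟨(r.1, φ ⟨s (L r.1), (hsL _ (hB' _ r.2).2).2⟩), hPf r.1 r.2⟩, s (L r.1),
      (hsL _ (hB' _ r.2).2).2, (hB' _ r.2).1.2.1, rfl, r.2, (hB' _ r.2).1.2.2⟩,
    fun j p hp => ?_, ?_, ?_⟩
  · exact hp.1
  · exact ⟨hp, isPlot_comp_of_contDiffAt hφ (K := s ∘ L) (isPlot_subtype_val.1 hp)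
      (fun t => (hsL _ (hB' _ (p t).2).2).1) (fun t => (hsL _ (hB' _ (p t).2).2).2)⟩
  · rintro ⟨p, u, hu, huA, hux, hr, hFL⟩
    refine Subtype.ext (Subtype.ext (Prod.ext rfl (Eq.trans (congrArg φ (Subtype.ext ?_)) hux)))
    change s (L p.1.1) = u
    rw [← hFL, hsF u huA]
  · exact fun r => rfl

end DiffeologicalEtale

theorem theorem6p10 {M : Type u} {N : Type v} [DiffeologicalSpace M] [DiffeologicalSpace N]
    (m n : ℕ) (hM : DiffeologicalEtale.IsEtaleManifold m M)
    (hN : DiffeologicalEtale.IsEtaleManifold n N)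
    (f : M → N) (hf : Diffeology.DSmooth f) :
    ((∀ x : M, Function.Surjective (DiffeologicalEtale.tangentMap hf x)) →
      DiffeologicalEtale.IsDiffeologicalSubmersion f) ∧
    ((∀ x : M, Function.Injective (DiffeologicalEtale.tangentMap hf x)) →
      DiffeologicalEtale.IsDiffeologicalImmersion f) ∧
    ((∀ x : M, Function.Bijective (DiffeologicalEtale.tangentMap hf x)) →
      DiffeologicalEtale.IsDiffeologicalEtale f) := by
  open DiffeologicalEtale in
  exact ⟨isDiffeologicalSubmersion_of_tangentMap_surjective hM hN hf,
    isDiffeologicalImmersion_of_tangentMap_injective hM hN hf,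
    isDiffeologicalEtale_of_tangentMap_bijective hM hN hf⟩
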